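/- A graph is a set $V(G)$ of vertices with a reflexive and symmetric edge relation $E(G)\subseteq V(G)^2$. A topological graph $G$ is a graph whose vertex space $V(G)$ is a zero-dimensional, compact, second-countable Hausdorff space and whose edge relation is closed in $V(G)^2$; finite graphs carry the discrete topology. If $E(G)$ is transitive, it is an equivalence relation, $|G|=V(G)/E(G)$ with the quotient topology is the topological realization of $G$, and $\pi\colon V(G)\to|G|$ is the quotient map. Dimension is small inductive dimension (which coincides with the other classical dimensions on compact metrizable spaces). A set $S\subseteq V(G)$ is connected if it is not the union of two nonempty relatively closed subsets $P,Q$ with no edge between a point of $P$ and a point of $Q$; the component of $S$ containing $a\in S$ is the union of all connected subsets of $S$ containing $a$; $G$ is connected if $V(G)$ is. An epimorphism $f\colon G\to H$ is a continuous map $V(G)\to V(H)$ that maps edges to edges and is surjective on vertices and on edges; it is confluent if for every connected $Q\subseteq V(H)$ and every component $C$ of $f^{-1}(Q)$ one has $f(C)=Q$. Let $\mathcal G$ be the class of nonempty finite connected graphs with confluent epimorphisms. Its projective Fraïssé limit $\mathbb G$ is the topological graph (unique up to isomorphism) such that, fixing a metric inducing the topology of $V(\mathbb G)$: (i) for every $A\in\mathcal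 G$ there is a confluent epimorphism $\mathbb G\to A$; (ii) for all $A,B\in\mathcal G$ and confluent epimorphisms $f\colon\mathbb G\to A$, $g\colon B\to A$ there is a confluent epimorphism $h\colon\mathbb G\to B$ with $f=g\circ h$; (iii) for every $\varepsilon>0$ there are $A\in\mathcal G$ and a confluent epimorphism $f\colon\mathbb G\to A$ all of whose fibres have diameter less than $\varepsilon$. Theorem. (1) Let $G$ be a topological graph with a transitive edge relation such that $\operatorname{card}(\pi^{-1}(x))\le 2$ for every $x\in|G|$. Then $\dim|G|\le 1$. (2) The edge relation of $\mathbb G$ is transitive and the topological realization $|\mathbb G|$ is a continuum (a nonempty compact connected metrizable space) of dimension exactly $1$. -/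

import Mathlib

universe u v w

/-- A graph in the sense of projective Fraïssé theory: a reflexive and symmetric edge relation
on the set `V` of vertices. -/
structure ReflGraph (V : Type u) where
  edge : V → V → Prop
  refl : ∀ a, edge a a
  symm : ∀ a b, edge a b → edge b a

namespace ReflGraph

/-- `G` is a topological graph: its vertex space is a zero-dimensional, compact, second-countable
Hausdorff space (hence metrizable) and the edge relation is a closed subset of the square.
The empty graph is allowed. -/
structure IsTopologicalGraph {V : Type u} [TopologicalSpace V] (G : ReflGraph V) : Prop where
  compact : CompactSpace V
  t2 : T2Space V
  secondCountable : SecondCountableTopology V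
  zeroDim : smallInductiveDimension V ≤ 0
  closedEdges : IsClosed {p : V × V | G.edge p.1 p.2}

/-- A topological graph with a transitive edge relation is called a prespace. -/
def IsPrespace {V : Type u} (G : ReflGraph V) : Prop :=
  ∀ a b c, G.edge a b → G.edge b c → G.edge a c

/-- The edge relation of a prespace, as an equivalence relation. -/
def edgeSetoid {V : Type u} (G : ReflGraph V) (h : G.IsPrespace) : Setoid V where
  r := G.edge
  iseqv := ⟨G.refl, fun {a b} => G.symm a b, fun {a b c} => h a b c⟩

/-- The topological realization `|G|` of a prespace: the quotient of the vertex space by the edge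
relation, with the quotient topology. -/
abbrev Realization {V : Type u} (G : ReflGraph V) (h : G.IsPrespace) : Type u :=
  Quotient (G.edgeSetoid h)

/-- The quotient map `π : G → |G|`. -/
def proj {V : Type u} (G : ReflGraph V) (h : G.IsPrespace) : V → G.Realization h :=
  Quotient.mk (G.edgeSetoid h)

/-- A set `S` of vertices is disconnected if it is the union of two nonempty, relatively closed
subsets with no edge from one to the other (so these subsets are disjoint by reflexivity). -/
def IsDisconnectedSet {V : Type u} [TopologicalSpace V] (G : ReflGraph V) (S : Set V) : Prop :=
  ∃ P Q : Set V, P.Nonempty ∧ Q.Nonempty ∧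
    (∃ C : Set V, IsClosed C ∧ P = S ∩ C) ∧ (∃ C : Set V, IsClosed C ∧ Q = S ∩ C) ∧
    P ∪ Q = S ∧ ∀ a ∈ P, ∀ b ∈ Q, ¬ G.edge a b

/-- A set of vertices is connected if it is not disconnected. -/
def IsConnectedSet {V : Type u} [TopologicalSpace V] (G : ReflGraph V) (S : Set V) : Prop :=
  ¬ G.IsDisconnectedSet S

/-- The component of `S` containing `a`: the union of all connected subsets of `S` containing
`a`. -/
def component {V : Type u} [TopologicalSpace V] (G : ReflGraph V) (S : Set V) (a : V) : Set V :=
  ⋃₀ {P : Set V | P ⊆ S ∧ a ∈ P ∧ G.IsConnectedSet P}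

/-- An epimorphism of topological graphs: a continuous homomorphism which is surjective on
vertices and on edges. -/
structure IsEpimorphism {V : Type u} {W : Type v} [TopologicalSpace V] [TopologicalSpace W]
    (G : ReflGraph V) (H : ReflGraph W) (f : V → W) : Prop where
  continuous : Continuous f
  hom : ∀ a b, G.edge a b → H.edge (f a) (f b)
  surjective : Function.Surjective f
  surjective_edge : ∀ c d, H.edge c d → ∃ a b, G.edge a b ∧ f a = c ∧ f b = d

/-- A confluent epimorphism: for every connected `Q`, every component of the preimage of `Q` is
mapped onto `Q`. -/
structure IsConfluentEpimorphism {V : Type u} {W : Type v} [TopologicalSpace V]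
    [TopologicalSpace W] (G : ReflGraph V) (H : ReflGraph W) (f : V → W) : Prop extends
    IsEpimorphism G H f where
  confluent : ∀ Q : Set W, H.IsConnectedSet Q → ∀ a ∈ f ⁻¹' Q, f '' G.component (f ⁻¹' Q) a = Q

/-- Membership in the class `𝒢` of finite connected (nonempty) graphs; finite graphs carry the
discrete topology. -/
structure IsFiniteConnected {A : Type w} [TopologicalSpace A] (G : ReflGraph A) : Prop where
  finite : Finite A
  nonempty : Nonempty A
  discrete : DiscreteTopology A
  connected : G.IsConnectedSet Set.univ

/-- An `ε`-map: all fibres have diameter less than `ε`. -/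
def IsEpsilonMap {V : Type u} {W : Type v} [MetricSpace V] (ε : ℝ) (f : V → W) : Prop :=
  ∀ x : W, Metric.diam (f ⁻¹' {x}) < ε

/-- `G` is the projective Fraïssé limit of the class of finite connected graphs with confluent
epimorphisms. The metric on `V` is any metric inducing the topology of the vertex space.
Every finite graph is isomorphic to one whose vertex set lives in `Type`. -/
structure IsConfluentFraisseLimit {V : Type u} [MetricSpace V] (G : ReflGraph V) : Prop extends
    IsTopologicalGraph G where
  projective : ∀ (A : Type) [TopologicalSpace A] (GA : ReflGraph A), GA.IsFiniteConnected →
    ∃ f : V → A, IsConfluentEpimorphism G GA f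
  extension : ∀ (A B : Type) [TopologicalSpace A] [TopologicalSpace B]
    (GA : ReflGraph A) (GB : ReflGraph B), GA.IsFiniteConnected → GB.IsFiniteConnected →
    ∀ (f : V → A) (g : B → A), IsConfluentEpimorphism G GA f → IsConfluentEpimorphism GB GA g →
    ∃ h : V → B, IsConfluentEpimorphism G GB h ∧ f = g ∘ h
  refinement : ∀ ε : ℝ, 0 < ε → ∃ (A : Type) (_ : TopologicalSpace A) (GA : ReflGraph A)
    (f : V → A), GA.IsFiniteConnected ∧ IsConfluentEpimorphism G GA f ∧ IsEpsilonMap ε f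

end ReflGraph

/-! For clopen `K`, the points of `|G|` whose whole fibre lies in `K` form an open set, and these
sets are a basis. A fibre over the frontier meets both `K` and `Kᶜ`; having at most two points, it
meets `K` exactly once. So the frontier is homeomorphic to a closed subset of `K`, hence
zero-dimensional, and `dim |G| ≤ 1`.

In the limit each vertex has at most one neighbour other than itself, which gives transitivity and
fibres of size at most two. Indeed, a map onto a finite `A` lifts through `edgeBlowup`, where `(x,
y)` has no neighbour over another vertex except `(y, x)`; if `a` and `c` are neighbours of `b` and
the map separates all three, both must be sent to the swap of the image of `b`.

The lower bound holds because `|𝔾|` is connected with more than one point. -/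

open Set Topology TopologicalSpace

/-! ### Closed surjections from compact zero-dimensional spaces -/

section ClosedSurjection

variable {X : Type u} {Y : Type v} [TopologicalSpace X] [TopologicalSpace Y] {f : X → Y}

theorem T2Space.of_isClosedMap_surjective [CompactSpace X] [T2Space X] (hf : Continuous f)
    (hcl : IsClosedMap f) (hs : Function.Surjective f) : T2Space Y := by
  have hpt : ∀ y : Y, IsClosed ({y} : Set Y) := fun y => by
    obtain ⟨x, rfl⟩ := hs y
    simpa using hcl _ (isClosed_singleton (x := x))
  refine ⟨fun y z hyz => ?_⟩
  obtain ⟨U, W, hU, hW, hyU, hzW, hUW⟩ := normal_separation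
    (s := f ⁻¹' {y}) (t := f ⁻¹' {z}) ((hpt y).preimage hf) ((hpt z).preimage hf)
    (Disjoint.preimage f (by simpa using hyz))
  refine ⟨kernImage f U, kernImage f W, isClosedMap_iff_kernImage.1 hcl hU,
    isClosedMap_iff_kernImage.1 hcl hW, fun x hx => hyU hx, fun x hx => hzW hx, ?_⟩
  refine Set.disjoint_left.2 fun w hw hw' => ?_
  obtain ⟨x, rfl⟩ := hs w
  exact Set.disjoint_left.1 hUW (hw rfl) (hw' rfl)

theorem frontier_kernImage_subset (hcl : IsClosedMap f) (hs : Function.Surjective f)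
    {K : Set X} (hK : IsClopen K) : frontier (kernImage f K) ⊆ f '' K ∩ f '' Kᶜ := by
  have hopen : IsOpen (kernImage f K) := isClosedMap_iff_kernImage.1 hcl hK.isOpen
  rw [hopen.frontier_eq]
  rintro y ⟨hy, hy'⟩
  refine ⟨closure_minimal ?_ (hcl _ hK.isClosed) hy, ?_⟩
  · intro w hw
    obtain ⟨x, rfl⟩ := hs w
    exact ⟨x, hw rfl, rfl⟩
  · rw [kernImage_eq_compl] at hy'
    simpa using hy'

variable [CompactSpace X] [TotallyDisconnectedSpace X]

/-- A clopen basis exists on every closed set over which the fibres of `f` meet a given closed set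
in at most one point. -/
theorem isTopologicalBasis_isClopen_of_subset_image [T2Space Y] (hf : Continuous f) {K : Set X}
    (hK : IsClosed K) {F : Set Y} (hF : IsClosed F) (hFK : F ⊆ f '' K)
    (hinj : ∀ a ∈ K, ∀ b ∈ K, f a ∈ F → f a = f b → a = b) :
    IsTopologicalBasis {s : Set F | IsClopen s} := by
  have hK' : IsClosed (K ∩ f ⁻¹' F) := hK.inter (hF.preimage hf)
  have := isCompact_iff_compactSpace.1 hK'.isCompact
  let g : (K ∩ f ⁻¹' F : Set X) → F := fun x => ⟨f x, x.2.2⟩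
  have hg : Continuous g := by fun_prop
  have hbij : Function.Bijective g := by
    refine ⟨fun a b hab => ?_, fun y => ?_⟩
    · exact Subtype.ext (hinj a a.2.1 b b.2.1 a.2.2 (congrArg Subtype.val hab))
    · obtain ⟨x, hx, hxy⟩ := hFK y.2
      exact ⟨⟨x, hx, by rw [mem_preimage, hxy]; exact y.2⟩, Subtype.ext hxy⟩
  -- A continuous bijection from a compact space to a Hausdorff one.
  let e := (isHomeomorph_iff_continuous_bijective.2 ⟨hg, hbij⟩).homeomorph
  have := e.totallyDisconnectedSpace
  have := e.compactSpace
  exact isTopologicalBasis_isClopen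

variable [T2Space X]

/-- A fibre inside an open set is compact, so finitely many clopen sets cover it within that open
set. -/
theorem isTopologicalBasis_kernImage_isClopen (hf : Continuous f) (hcl : IsClosedMap f)
    (hs : Function.Surjective f) :
    IsTopologicalBasis (kernImage f '' {K : Set X | IsClopen K}) := by
  have := T2Space.of_isClosedMap_surjective hf hcl hs
  refine isTopologicalBasis_of_isOpen_of_nhds ?_ fun y U hy hU => ?_
  · rintro _ ⟨K, hK, rfl⟩
    exact isClosedMap_iff_kernImage.1 hcl hK.isOpen
  · have hcpt : IsCompact (f ⁻¹' {y}) := (isClosed_singleton.preimage hf).isCompact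
    have hsub : f ⁻¹' {y} ⊆ f ⁻¹' U := preimage_mono (singleton_subset_iff.2 hy)
    have hloc : ∀ x ∈ f ⁻¹' {y}, ∃ K : Set X, IsClopen K ∧ x ∈ K ∧ K ⊆ f ⁻¹' U := fun x hx =>
      compact_exists_isClopen_in_isOpen (hU.preimage hf) (hsub hx)
    choose! K hK hxK hKU using hloc
    obtain ⟨t, ht, hcov⟩ := hcpt.elim_nhds_subcover K
      fun x hx => (hK x hx).isOpen.mem_nhds (hxK x hx)
    refine ⟨_, ⟨⋃ x ∈ t, K x, isClopen_biUnion_finset fun x hx => hK x (ht x hx), rfl⟩,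
      fun x hx => hcov hx, fun w hw => ?_⟩
    obtain ⟨x, rfl⟩ := hs w
    obtain ⟨z, hz, hxz⟩ := mem_iUnion₂.1 (hw rfl)
    exact hKU z (ht z hz) hxz

theorem SecondCountableTopology.of_isClosedMap_surjective [SecondCountableTopology X]
    (hf : Continuous f) (hcl : IsClosedMap f) (hs : Function.Surjective f) :
    SecondCountableTopology Y := by
  have hc : Countable (Clopens X) := Clopens.countable_iff_secondCountable.2 inferInstance
  refine (isTopologicalBasis_kernImage_isClopen hf hcl hs).secondCountableTopology
    (Set.Countable.image ?_ _)
  refine (Set.countable_range fun K : Clopens X => (K : Set X)).mono fun K hK => ?_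
  exact ⟨⟨K, hK⟩, rfl⟩

theorem HasSmallInductiveDimensionLE.one_of_isClosedMap_surjective (hf : Continuous f)
    (hcl : IsClosedMap f) (hs : Function.Surjective f)
    (hfib : ∀ y, (f ⁻¹' {y}).encard ≤ 2) : HasSmallInductiveDimensionLE Y 1 := by
  have := T2Space.of_isClosedMap_surjective hf hcl hs
  refine .succ 1 _ (isTopologicalBasis_kernImage_isClopen hf hcl hs) ?_
  rintro _ ⟨K, hK, rfl⟩
  have hfr := frontier_kernImage_subset hcl hs hK
  refine hasSmallInductiveDimensionLT_one_iff.2 (isTopologicalBasis_isClopen_of_subset_image hf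
    hK.isClosed isClosed_frontier (hfr.trans inter_subset_left) fun a ha b hb hy hab => ?_)
  obtain ⟨c, hc, hca⟩ := (hfr hy).2
  by_contra hne
  -- The point `c` of the fibre lies outside `K`, so distinct `a`, `b` in `K` would make three.
  have h3 : ({a, b, c} : Set X).encard = 3 :=
    encard_eq_three.2 ⟨a, b, c, hne, fun h => hc (h ▸ ha), fun h => hc (h ▸ hb), rfl⟩
  have hle : ({a, b, c} : Set X).encard ≤ 2 := by
    refine (encard_le_encard ?_).trans (hfib (f a))
    rintro x (rfl | rfl | rfl)
    exacts [rfl, hab.symm, hca]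
  rw [h3] at hle
  exact absurd hle (by decide)

end ClosedSurjection

theorem not_hasSmallInductiveDimensionLT_one (X : Type u) [TopologicalSpace X] [T1Space X]
    [PreconnectedSpace X] [Nontrivial X] : ¬ HasSmallInductiveDimensionLT X 1 := by
  intro h
  obtain ⟨x, y, hxy⟩ := exists_pair_ne X
  obtain ⟨K, hK, hxK, hKy⟩ := (hasSmallInductiveDimensionLT_one_iff.1 h).exists_subset_of_mem_open
    (show x ∈ ({y}ᶜ : Set X) from hxy) isOpen_compl_singleton
  rcases isClopen_iff.1 hK with rfl | rfl
  · exact hxK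
  · exact hKy (mem_univ y) rfl

namespace ReflGraph

/-! ### The realization of a prespace -/

section Prespace

variable {V : Type u} {G : ReflGraph V}

theorem surjective_proj (h : G.IsPrespace) : Function.Surjective (G.proj h) :=
  Quotient.mk_surjective

theorem proj_eq_proj_iff (h : G.IsPrespace) {a b : V} :
    G.proj h a = G.proj h b ↔ G.edge a b :=
  Quotient.eq

variable [TopologicalSpace V]

theorem IsTopologicalGraph.totallyDisconnectedSpace (hG : G.IsTopologicalGraph) :
    TotallyDisconnectedSpace V := by
  have := hG.t2
  have := totallySeparatedSpace_of_t0_of_basis_clopen (hasSmallInductiveDimensionLT_one_iff.1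
    ((smallInductiveDimension_le_iff (n := 0)).1 (by exact_mod_cast hG.zeroDim)))
  infer_instance

theorem continuous_proj (h : G.IsPrespace) : Continuous (G.proj h) :=
  continuous_quot_mk

theorem IsTopologicalGraph.isClosedMap_proj (hG : G.IsTopologicalGraph) (h : G.IsPrespace) :
    IsClosedMap (G.proj h) := by
  have := hG.compact
  intro C hC
  rw [← (isQuotientMap_quotient_mk' (s := G.edgeSetoid h)).isClosed_preimage]
  -- The saturation of `C` is the projection of a closed set along a compact factor.
  have heq : G.proj h ⁻¹' (G.proj h '' C) =
      Prod.snd '' ({p : V × V | G.edge p.1 p.2} ∩ Prod.fst ⁻¹' C) := by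
    ext b
    constructor
    · rintro ⟨a, ha, hab⟩
      exact ⟨(a, b), ⟨(proj_eq_proj_iff h).1 hab, ha⟩, rfl⟩
    · rintro ⟨⟨a, _⟩, ⟨hab, ha⟩, rfl⟩
      exact ⟨a, ha, (proj_eq_proj_iff h).2 hab⟩
  change IsClosed (G.proj h ⁻¹' (G.proj h '' C))
  rw [heq]
  exact isClosedMap_snd_of_compactSpace _ (hG.closedEdges.inter (hC.preimage continuous_fst))

theorem IsTopologicalGraph.hasSmallInductiveDimensionLE_one_realization
    (hG : G.IsTopologicalGraph) (h : G.IsPrespace)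
    (hfib : ∀ x : G.Realization h, (G.proj h ⁻¹' {x}).encard ≤ 2) :
    HasSmallInductiveDimensionLE (G.Realization h) 1 := by
  have := hG.compact
  have := hG.t2
  have := hG.totallyDisconnectedSpace
  exact .one_of_isClosedMap_surjective (continuous_proj h) (hG.isClosedMap_proj h)
    (surjective_proj h) hfib

theorem IsTopologicalGraph.metrizableSpace_realization (hG : G.IsTopologicalGraph)
    (h : G.IsPrespace) : MetrizableSpace (G.Realization h) := by
  have := hG.compact
  have := hG.t2
  have := hG.secondCountable
  have := hG.totallyDisconnectedSpace
  have hc := continuous_proj h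
  have hcl := hG.isClosedMap_proj h
  have hs := surjective_proj h
  have := T2Space.of_isClosedMap_surjective hc hcl hs
  have := SecondCountableTopology.of_isClosedMap_surjective hc hcl hs
  infer_instance

theorem preconnectedSpace_realization (h : G.IsPrespace) (hG : G.IsConnectedSet univ) :
    PreconnectedSpace (G.Realization h) := by
  rw [preconnectedSpace_iff_clopen]
  intro K hK
  by_contra! hne
  refine hG ⟨G.proj h ⁻¹' K, G.proj h ⁻¹' Kᶜ, ?_, ?_,
    ⟨_, hK.isClosed.preimage (continuous_proj h), (univ_inter _).symm⟩,
    ⟨_, hK.compl.isClosed.preimage (continuous_proj h), (univ_inter _).symm⟩,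
    union_compl_self _, fun a ha b hb hab => hb ?_⟩
  · exact Set.Nonempty.preimage hne.1 (surjective_proj h)
  · exact (nonempty_compl.2 hne.2).preimage (surjective_proj h)
  · rw [← (proj_eq_proj_iff h).2 hab]
    exact ha

end Prespace

/-! ### Finite test graphs -/

section FiniteGraphs

/-- The graph obtained from `G` by blowing up every vertex to a clique with one vertex for each
incident edge, distinct edges of `G` becoming disjoint. -/
def edgeBlowup {A : Type u} (G : ReflGraph A) : ReflGraph {p : A × A // G.edge p.1 p.2} where
  edge p q := p.1.1 = q.1.1 ∨ p.1 = q.1.swap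
  refl _ := .inl rfl
  symm p q h := h.imp Eq.symm fun h => by rw [h, Prod.swap_swap]

theorem isDisconnectedSet_iff_of_discreteTopology {A : Type u} [TopologicalSpace A]
    [DiscreteTopology A] {G : ReflGraph A} {S : Set A} :
    G.IsDisconnectedSet S ↔ ∃ P Q : Set A, P.Nonempty ∧ Q.Nonempty ∧ P ∪ Q = S ∧
      ∀ a ∈ P, ∀ b ∈ Q, ¬ G.edge a b := by
  constructor
  · rintro ⟨P, Q, hP, hQ, -, -, h⟩
    exact ⟨P, Q, hP, hQ, h⟩
  · rintro ⟨P, Q, hP, hQ, rfl, h⟩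
    exact ⟨P, Q, hP, hQ, ⟨P, isClosed_discrete P, by simp⟩, ⟨Q, isClosed_discrete Q, by simp⟩,
      rfl, h⟩

variable {A : Type u} [TopologicalSpace A] [DiscreteTopology A] {G : ReflGraph A}

theorem IsConnectedSet.edgeBlowup_preimage_fst {Q : Set A} (hQ : G.IsConnectedSet Q) :
    G.edgeBlowup.IsConnectedSet ((fun p => p.1.1) ⁻¹' Q) := by
  intro hd
  obtain ⟨P, R, ⟨p, hp⟩, ⟨r, hr⟩, hPR, hno⟩ := isDisconnectedSet_iff_of_discreteTopology.1 hd
  refine hQ (isDisconnectedSet_iff_of_discreteTopology.2 ⟨(fun p => p.1.1) '' P,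
    (fun p => p.1.1) '' R, ⟨_, p, hp, rfl⟩, ⟨_, r, hr, rfl⟩, ?_, ?_⟩)
  · rw [← image_union, hPR, image_preimage_eq]
    exact fun a => ⟨⟨(a, a), G.refl a⟩, rfl⟩
  · rintro _ ⟨p, hp, rfl⟩ _ ⟨r, hr, rfl⟩ hpr
    have hpQ : p.1.1 ∈ Q := hPR.subset (Or.inl hp)
    have hrQ : r.1.1 ∈ Q := hPR.subset (Or.inr hr)
    let p' : {p : A × A // G.edge p.1 p.2} := ⟨(p.1.1, r.1.1), hpr⟩
    let r' : {p : A × A // G.edge p.1 p.2} := ⟨(r.1.1, p.1.1), G.symm _ _ hpr⟩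
    -- The clique over a vertex cannot be split, so `p'` stays with `p` and `r'` with `r`.
    have hp' : p' ∈ P :=
      (hPR.superset (show p'.1.1 ∈ Q from hpQ)).resolve_right fun h => hno p hp p' h (.inl rfl)
    have hr' : r' ∈ R :=
      (hPR.superset (show r'.1.1 ∈ Q from hrQ)).resolve_left fun h => hno r' h r hr (.inl rfl)
    exact hno p' hp' r' hr' (.inr rfl)

theorem isConfluentEpimorphism_edgeBlowup_fst :
    IsConfluentEpimorphism G.edgeBlowup G (fun p => p.1.1) where
  continuous := continuous_of_discreteTopology
  hom p q h := by
    rcases h with h | h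
    · rw [h]
      exact G.refl _
    · have := p.2
      rw [h] at this ⊢
      exact this
  surjective a := ⟨⟨(a, a), G.refl a⟩, rfl⟩
  surjective_edge c d h := ⟨⟨(c, d), h⟩, ⟨(d, c), G.symm _ _ h⟩, .inr rfl, rfl, rfl⟩
  confluent Q hQ a ha := by
    refine Subset.antisymm ?_ fun c hc => ?_
    · rintro _ ⟨x, ⟨P, ⟨hP, -, -⟩, hx⟩, rfl⟩
      exact hP hx
    -- The whole preimage is connected, hence is the only component.
    · exact ⟨⟨(c, c), G.refl c⟩, ⟨_, ⟨Subset.rfl, ha, hQ.edgeBlowup_preimage_fst⟩, hc⟩, rfl⟩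

theorem IsFiniteConnected.edgeBlowup (hG : G.IsFiniteConnected) :
    G.edgeBlowup.IsFiniteConnected where
  finite := by
    have := hG.finite
    infer_instance
  nonempty := hG.nonempty.map fun a => ⟨(a, a), G.refl a⟩
  discrete := inferInstance
  connected := by simpa using hG.connected.edgeBlowup_preimage_fst

/-- The path with three vertices. -/
def threePath : ReflGraph (Fin 3) where
  edge i j := i = j ∨ i = 1 ∨ j = 1
  refl _ := .inl rfl
  symm _ _ h := h.elim (fun h => .inl h.symm) fun h => .inr h.symm

theorem isFiniteConnected_threePath : threePath.IsFiniteConnected where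
  finite := inferInstance
  nonempty := inferInstance
  discrete := inferInstance
  connected hd := by
    obtain ⟨P, Q, ⟨p, hp⟩, ⟨q, hq⟩, hPQ, hno⟩ := isDisconnectedSet_iff_of_discreteTopology.1 hd
    rcases hPQ.superset (mem_univ 1) with h | h
    · exact hno 1 h q hq (.inr (.inl rfl))
    · exact hno p hp 1 h (.inr (.inr rfl))

end FiniteGraphs

/-! ### The projective Fraïssé limit -/

namespace IsConfluentFraisseLimit

variable {V : Type u} [MetricSpace V] {G : ReflGraph V}

theorem exists_dist_lt (hG : G.IsConfluentFraisseLimit) {ε : ℝ} (hε : 0 < ε) :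
    ∃ (A : Type) (_ : TopologicalSpace A) (GA : ReflGraph A) (f : V → A),
      GA.IsFiniteConnected ∧ IsConfluentEpimorphism G GA f ∧
        ∀ a b, f a = f b → dist a b < ε := by
  obtain ⟨A, tA, GA, f, hA, hf, hd⟩ := hG.refinement ε hε
  have := hG.compact
  refine ⟨A, tA, GA, f, hA, hf, fun a b hab => ?_⟩
  exact (Metric.dist_le_diam_of_mem (Metric.isBounded_of_compactSpace)
    (show a ∈ f ⁻¹' {f b} from hab) (show b ∈ f ⁻¹' {f b} from rfl)).trans_lt (hd _)

theorem eq_of_edge_of_edge (hG : G.IsConfluentFraisseLimit) {a b c : V} (hab : G.edge a b)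
    (hbc : G.edge b c) (hne : a ≠ b) (hne' : b ≠ c) : a = c := by
  by_contra hac
  -- This bound forces `f` to separate `a`, `b`, `c` pairwise.
  obtain ⟨A, tA, GA, f, hA, hf, hd⟩ := hG.exists_dist_lt
    (lt_min (dist_pos.2 hne) (lt_min (dist_pos.2 hne') (dist_pos.2 hac)))
  have := hA.discrete
  obtain ⟨h, hh, rfl⟩ := hG.extension A _ GA GA.edgeBlowup hA hA.edgeBlowup f _ hf
    isConfluentEpimorphism_edgeBlowup_fst
  have h1 : h a = ⟨(h b).1.swap, GA.symm _ _ (h b).2⟩ := by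
    rcases hh.hom a b hab with e | e
    · exact absurd (hd a b e) (not_lt.2 (min_le_left _ _))
    · exact Subtype.ext e
  have h2 : (h b).1 = (h c).1.swap := by
    rcases hh.hom b c hbc with e | e
    · exact absurd (hd b c e) (not_lt.2 ((min_le_right _ _).trans (min_le_left _ _)))
    · exact e
  refine absurd (hd a c ?_) (not_lt.2 ((min_le_right _ _).trans (min_le_right _ _)))
  simp [h1, h2]

theorem isPrespace (hG : G.IsConfluentFraisseLimit) : G.IsPrespace := by
  intro a b c hab hbc
  by_cases hne : a = b
  · exact hne ▸ hbc
  by_cases hne' : b = c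
  · exact hne' ▸ hab
  · exact hG.eq_of_edge_of_edge hab hbc hne hne' ▸ G.refl a

theorem encard_proj_preimage_le (hG : G.IsConfluentFraisseLimit) (h : G.IsPrespace)
    (x : G.Realization h) : (G.proj h ⁻¹' {x}).encard ≤ 2 := by
  by_contra! hlt
  obtain ⟨s, hs, hs3⟩ := exists_subset_encard_eq (k := 3) (Order.add_one_le_of_lt hlt)
  obtain ⟨a, b, c, hab, hac, hbc, rfl⟩ := encard_eq_three.1 hs3
  have ha : G.proj h a = x := hs (by simp)
  have hb : G.proj h b = x := hs (by simp)
  have hc : G.proj h c = x := hs (by simp)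
  exact hac (hG.eq_of_edge_of_edge ((proj_eq_proj_iff h).1 (ha.trans hb.symm))
    ((proj_eq_proj_iff h).1 (hb.trans hc.symm)) hab hbc)

/-- Two separated closed pieces are at positive distance, so small fibres do not straddle them; as
edges of `A` lift, the images would disconnect `A`. -/
theorem isConnectedSet_univ (hG : G.IsConfluentFraisseLimit) : G.IsConnectedSet univ := by
  rintro ⟨P, Q, hP, hQ, ⟨C, hC, rfl⟩, ⟨D, hD, rfl⟩, hPQ, hno⟩
  simp only [univ_inter] at hP hQ hPQ hno
  have := hG.compact
  have hdisj : Disjoint C D := Set.disjoint_left.2 fun a ha ha' => hno a ha a ha' (G.refl a)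
  obtain ⟨ε, hε, hεd⟩ := hdisj.exists_thickenings hC.isCompact hD
  have hsep : ∀ a ∈ C, ∀ b ∈ D, ε ≤ dist a b := fun a ha b hb => by
    by_contra! hlt
    exact Set.disjoint_left.1 hεd (Metric.mem_thickening_iff.2 ⟨a, ha, by rwa [dist_comm]⟩)
      (Metric.self_subset_thickening hε D hb)
  obtain ⟨A, tA, GA, f, hA, hf, hd⟩ := hG.exists_dist_lt hε
  have := hA.discrete
  refine hA.connected (isDisconnectedSet_iff_of_discreteTopology.2
    ⟨f '' C, f '' D, hP.image f, hQ.image f, ?_, ?_⟩)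
  · rw [← image_union, hPQ, image_univ, hf.surjective.range_eq]
  · rintro _ ⟨a, ha, rfl⟩ _ ⟨b, hb, rfl⟩ hab
    obtain ⟨x, y, hxy, hx, hy⟩ := hf.surjective_edge _ _ hab
    have hxC : x ∈ C := (hPQ.superset (mem_univ x)).resolve_right fun h =>
      (hd a x hx.symm).not_ge (hsep a ha x h)
    have hyD : y ∈ D := (hPQ.superset (mem_univ y)).resolve_left fun h =>
      (hd y b hy).not_ge (hsep y h b hb)
    exact hno x hxC y hyD hxy

/-- The ends of `threePath` are not adjacent, so points above them are not identified. -/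
theorem nontrivial_realization (hG : G.IsConfluentFraisseLimit) (h : G.IsPrespace) :
    Nontrivial (G.Realization h) := by
  obtain ⟨f, hf⟩ := hG.projective _ _ isFiniteConnected_threePath
  obtain ⟨a, ha⟩ := hf.surjective 0
  obtain ⟨b, hb⟩ := hf.surjective 2
  refine ⟨G.proj h a, G.proj h b, fun hab => ?_⟩
  have := hf.hom a b ((proj_eq_proj_iff h).1 hab)
  rw [ha, hb] at this
  simp [threePath] at this

end IsConfluentFraisseLimit

end ReflGraph

theorem mainTheorem9 :
    (∀ (V : Type u) [TopologicalSpace V] (G : ReflGraph V), G.IsTopologicalGraph →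
      ∀ h : G.IsPrespace, (∀ x : G.Realization h, (G.proj h ⁻¹' {x}).encard ≤ 2) →
        smallInductiveDimension (G.Realization h) ≤ 1) ∧
    (∀ (V : Type u) [MetricSpace V] (G : ReflGraph V), G.IsConfluentFraisseLimit →
      ∃ h : G.IsPrespace,
        CompactSpace (G.Realization h) ∧ ConnectedSpace (G.Realization h) ∧
        TopologicalSpace.MetrizableSpace (G.Realization h) ∧
        smallInductiveDimension (G.Realization h) = 1) := by
  refine ⟨fun V _ G hG h hfib => smallInductiveDimension_le_iff.2
    (hG.hasSmallInductiveDimensionLE_one_realization h hfib), fun V _ G hG => ?_⟩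
  have h := hG.isPrespace
  have := hG.compact
  have := hG.metrizableSpace_realization h
  have := G.preconnectedSpace_realization h hG.isConnectedSet_univ
  have := hG.nontrivial_realization h
  exact ⟨h, inferInstance, ⟨inferInstance⟩, inferInstance, smallInductiveDimension_eq 1
    (hG.hasSmallInductiveDimensionLE_one_realization h (hG.encard_proj_preimage_le h))
    (not_hasSmallInductiveDimensionLT_one _)⟩
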